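/- Let $G$ be a locally compact (Hausdorff) group with a fixed left Haar measure $\mu$, and $L^2(G)=L^2(G,\mu)$. A unitary representation of $G$ on a complex Hilbert space $\mathcal{H}_\pi$ is a group homomorphism $\pi:G\to\mathcal{U}(\mathcal{H}_\pi)$ such that for all $f,g\in\mathcal{H}_\pi$ the wavelet transform $\mathcal{W}_gf(x):=\langle f,\pi(x)g\rangle$ is a continuous function of $x\in G$. A nonzero vector $g\in\mathcal{H}_\pi$ is square integrable if $\mathcal{W}_gg\in L^2(G)$, and $\pi$ is square integrable if it is irreducible and has a square integrable vector. A square integrable vector $g$ is admissible if $\|\mathcal{W}_gg\|_{L^2(G)}=\|g\|$; equivalently, $\|C_\pi g\|=1$, where $C_\pi$ is the Duflo–Moore operator of $\pi$, i.e. the positive densely defined operator whose domain consists of $0$ and the square integrable vectors and which satisfies $\langle\mathcal{W}_{g_1}f_1,\mathcal{W}_{g_2}f_2\rangle_{L^2(G)}=\langle f_1,f_2\rangle\,\overline{\langle C_\pi g_1,C_\pi g_2\rangle}$. For admissible $g$, the wavelet space is the subspace $\mathcal{W}_g(\mathcal{H}_\pi)=\{\mathcal{W}_gf: f\in\mathcal{H}_\pi\}$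 of $L^2(G)$. **Theorem.** Let $\pi:G\to\mathcal{U}(\mathcal{H}_\pi)$ and $\rho:G\to\mathcal{U}(\mathcal{H}_\rho)$ be square integrable representations with admissible vectors $g\in\mathcal{H}_\pi$ and $h\in\mathcal{H}_\rho$. If $\mathcal{W}_g(\mathcal{H}_\pi)\cap\mathcal{W}_h(\mathcal{H}_\rho)\neq\{0\}$, then $\mathcal{W}_g(\mathcal{H}_\pi)=\mathcal{W}_h(\mathcal{H}_\rho)$, and there exists a unitary operator $T:\mathcal{H}_\pi\to\mathcal{H}_\rho$ with $T\pi(x)=\rho(x)T$ for all $x\in G$ and $T(g)=h$. -/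

import Mathlib

open MeasureTheory
open scoped ENNReal ComplexConjugate

noncomputable section

namespace WaveletSpaces

/-- The wavelet transform `𝒲_g f (x) = ⟨f, π(x) g⟩` of `f` with respect to `g`. Mathlib's inner
product is conjugate-linear in its first argument, so the two arguments are exchanged. -/
def waveletTransform {G H : Type*} [Group G]
    [NormedAddCommGroup H] [InnerProductSpace ℂ H] [CompleteSpace H]
    (π : G →* unitary (H →L[ℂ] H)) (g f : H) : G → ℂ :=
  fun x => inner ℂ ((π x : H →L[ℂ] H) g) f

/-- A group homomorphism into the unitary operators is a unitary representation if all its wavelet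
transforms (matrix coefficients) are continuous. -/
def IsUnitaryRepresentation {G H : Type*} [Group G] [TopologicalSpace G]
    [NormedAddCommGroup H] [InnerProductSpace ℂ H] [CompleteSpace H]
    (π : G →* unitary (H →L[ℂ] H)) : Prop :=
  ∀ f g : H, Continuous (waveletTransform π g f)

/-- Irreducibility: there is no non-trivial closed invariant subspace. -/
def IsIrreducibleRep {G H : Type*} [Group G]
    [NormedAddCommGroup H] [InnerProductSpace ℂ H] [CompleteSpace H]
    (π : G →* unitary (H →L[ℂ] H)) : Prop :=
  ∀ M : Submodule ℂ H, IsClosed (M : Set H) →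
    (∀ x : G, ∀ η ∈ M, (π x : H →L[ℂ] H) η ∈ M) → M = ⊥ ∨ M = ⊤

/-- A non-zero vector `g` is square integrable if `𝒲_g g ∈ L²(G)`. -/
def IsSquareIntegrableVector {G H : Type*} [Group G] [MeasurableSpace G]
    [NormedAddCommGroup H] [InnerProductSpace ℂ H] [CompleteSpace H]
    (π : G →* unitary (H →L[ℂ] H)) (μ : Measure G) (g : H) : Prop :=
  g ≠ 0 ∧ MemLp (waveletTransform π g g) 2 μ

/-- A square integrable representation: an irreducible unitary representation that has a square
integrable vector. -/
structure IsSquareIntegrableRep {G H : Type*} [Group G] [TopologicalSpace G] [MeasurableSpace G]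
    [NormedAddCommGroup H] [InnerProductSpace ℂ H] [CompleteSpace H]
    (π : G →* unitary (H →L[ℂ] H)) (μ : Measure G) : Prop where
  isUnitaryRepresentation : IsUnitaryRepresentation π
  isIrreducible : IsIrreducibleRep π
  exists_vector : ∃ g : H, IsSquareIntegrableVector π μ g

/-- A square integrable vector `g` is admissible if `‖𝒲_g g‖_{L²(G)} = ‖g‖`. By the orthogonality
relations this is the normalization `‖C g‖ = 1` for the Duflo-Moore operator `C` of the
representation: see `isAdmissible_iff_norm_dufloMoore`. -/
def IsAdmissible {G H : Type*} [Group G] [MeasurableSpace G]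
    [NormedAddCommGroup H] [InnerProductSpace ℂ H] [CompleteSpace H]
    (π : G →* unitary (H →L[ℂ] H)) (μ : Measure G) (g : H) : Prop :=
  IsSquareIntegrableVector π μ g ∧ eLpNorm (waveletTransform π g g) 2 μ = ‖g‖ₑ

/-- If `C` is an operator whose domain consists of `0` and the square integrable vectors, and which
satisfies the Duflo-Moore orthogonality relations
`⟨𝒲_{g₁} f₁, 𝒲_{g₂} f₂⟩ = ⟨f₁, f₂⟩ * conj ⟨C g₁, C g₂⟩`, then `g` is admissible if and only if it is
a square integrable vector with `‖C g‖ = 1`. -/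
theorem isAdmissible_iff_norm_dufloMoore {G H : Type*} [Group G] [MeasurableSpace G]
    [NormedAddCommGroup H] [InnerProductSpace ℂ H] [CompleteSpace H]
    (π : G →* unitary (H →L[ℂ] H)) (μ : Measure G) (C : H →ₗ.[ℂ] H)
    (hdom : ∀ g : H, g ≠ 0 → (IsSquareIntegrableVector π μ g ↔ g ∈ C.domain))
    (horth : ∀ (g₁ g₂ : C.domain) (f₁ f₂ : H),
      ∫ x, waveletTransform π (g₁ : H) f₁ x * conj (waveletTransform π (g₂ : H) f₂ x) ∂μ =
        inner ℂ f₂ f₁ * conj (inner ℂ (C g₂) (C g₁)))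
    (g : H) :
    IsAdmissible π μ g ↔
      IsSquareIntegrableVector π μ g ∧ ∃ hg : g ∈ C.domain, ‖C ⟨g, hg⟩‖ = 1 := by
  refine and_congr_right fun hs => ?_
  have hg : g ∈ C.domain := (hdom g hs.1).1 hs
  have hn : 0 < ‖g‖ := norm_pos_iff.2 hs.1
  have key : (∫ x, ‖waveletTransform π g g x‖ ^ 2 ∂μ) = ‖g‖ ^ 2 * ‖C ⟨g, hg⟩‖ ^ 2 := by
    have h := horth ⟨g, hg⟩ ⟨g, hg⟩ g g
    simp only [Complex.mul_conj', inner_self_eq_norm_sq_to_K] at h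
    have h2 : ((∫ x, ‖waveletTransform π g g x‖ ^ 2 ∂μ : ℝ) : ℂ) =
        ((‖g‖ ^ 2 * ‖C ⟨g, hg⟩‖ ^ 2 : ℝ) : ℂ) := by
      rw [← integral_complex_ofReal]
      simpa using h
    exact_mod_cast h2
  have hE : eLpNorm (waveletTransform π g g) 2 μ =
      ENNReal.ofReal (‖g‖ * ‖C ⟨g, hg⟩‖) := by
    rw [hs.2.eLpNorm_eq_integral_rpow_norm (by norm_num) (by norm_num)]
    congr 1
    simp only [ENNReal.toReal_ofNat, Real.rpow_ofNat]
    rw [key, ← mul_pow, ← one_div, ← Real.sqrt_eq_rpow, Real.sqrt_sq (by positivity)]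
  rw [hE, ← ofReal_norm,
    ENNReal.ofReal_eq_ofReal_iff (by positivity) (by positivity)]
  constructor
  · intro h
    exact ⟨hg, by simpa [hn.ne'] using h⟩
  · rintro ⟨_, h⟩
    rw [h, mul_one]

/-- The wavelet space `𝒲_g(H) ⊆ L²(G)`, as a subspace of `L²(G)`: the classes of the
functions `𝒲_g f`, `f ∈ H` (for a square integrable vector `g` of an irreducible unitary
representation, all of them lie in `L²(G)`). -/
def waveletSpace {G H : Type*} [Group G] [MeasurableSpace G]
    [NormedAddCommGroup H] [InnerProductSpace ℂ H] [CompleteSpace H]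
    (π : G →* unitary (H →L[ℂ] H)) (μ : Measure G) (g : H) : Submodule ℂ (Lp ℂ 2 μ) where
  carrier := {F | ∃ f : H, F =ᵐ[μ] waveletTransform π g f}
  zero_mem' := ⟨0, by
    filter_upwards [Lp.coeFn_zero ℂ 2 μ] with x hx
    rw [hx]; simp [waveletTransform]⟩
  add_mem' := by
    rintro F₁ F₂ ⟨f₁, h₁⟩ ⟨f₂, h₂⟩
    refine ⟨f₁ + f₂, ?_⟩
    filter_upwards [h₁, h₂, Lp.coeFn_add F₁ F₂] with x hx₁ hx₂ hx
    rw [hx, Pi.add_apply, hx₁, hx₂]; simp [waveletTransform, inner_add_right]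
  smul_mem' := by
    rintro c F ⟨f, h⟩
    refine ⟨c • f, ?_⟩
    filter_upwards [h, Lp.coeFn_smul c F] with x hx₁ hx
    rw [hx, Pi.smul_apply, hx₁]; simp [waveletTransform, inner_smul_right]

end WaveletSpaces

end

/-!
The idea is that each wavelet space is the isometric copy, inside `L²(G)`, of an irreducible
representation, with translation as the group action.

*The wavelet transform is isometric.* A priori `𝒲_g` is only a densely defined closed operator
`H → L²(G)`. Its graph `Γ` is a Hilbert space on which `G` acts unitarily by `π` on the first and
by left translation on the second component, and the first projection `j : Γ → H` is bounded,
injective and equivariant. Hence `j j†` is a self-adjoint operator commuting with `π`, and by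
Schur's lemma (`eq_algebraMap_of_commute`) it is a scalar `c`, which is not `0` because `Γ` is not.
So `j` is surjective with `j† j = c`, that is, `‖f‖² = c (‖f‖² + ‖𝒲_g f‖²)` for every `f`, and
`𝒲_g` is a multiple of an isometry, defined everywhere. Admissibility fixes the multiple to be `1`
(`exists_linearIsometry`).

*Two wavelet spaces that meet are equal.* The vectors `f` with `𝒲_g f ∈ 𝒲_h(K)` form a closed
`π`-invariant subspace of `H`, because `𝒲_h(K)` is closed and translation invariant. If the wavelet
spaces meet nontrivially, this subspace is all of `H` by irreducibility
(`exists_waveletTransform_eq`); exchanging the roles gives equality. Then `T = 𝒲_h⁻¹ 𝒲_g` is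
unitary and intertwines the representations. Evaluating `𝒲_g f = 𝒲_h (T f)` at the unit element
gives `⟨f, g⟩ = ⟨T f, h⟩ = ⟨f, T⁻¹ h⟩` for all `f`, whence `T g = h`.
-/

open Filter Topology
open scoped InnerProduct

namespace WaveletSpaces

/-! ### Unitary representations and Schur's lemma -/

section Schur

variable {G H : Type*} [Group G] [NormedAddCommGroup H] [InnerProductSpace ℂ H] [CompleteSpace H]
  (π : G →* unitary (H →L[ℂ] H))

theorem rep_mul_apply (x y : G) (f : H) :
    (π (x * y) : H →L[ℂ] H) f = (π x : H →L[ℂ] H) ((π y : H →L[ℂ] H) f) := by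
  simp

theorem inner_rep_rep (x : G) (u v : H) :
    inner ℂ ((π x : H →L[ℂ] H) u) ((π x : H →L[ℂ] H) v) = inner ℂ u v := by
  rw [← ContinuousLinearMap.adjoint_inner_right, ← ContinuousLinearMap.star_eq_adjoint,
    ← mul_apply_eq_comp, Unitary.coe_star_mul_self, one_apply_eq_self]

theorem inner_rep_inv_left (x : G) (u v : H) :
    inner ℂ ((π x⁻¹ : H →L[ℂ] H) u) v = inner ℂ u ((π x : H →L[ℂ] H) v) := by
  rw [← inner_rep_rep π x, ← rep_mul_apply]
  simp

/-- Schur's lemma for self-adjoint operators: two points of the spectrum could be separated by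
continuous functions with product `0`, and the kernel of one of the resulting operators would be a
nontrivial closed invariant subspace. -/
theorem eq_algebraMap_of_commute [Nontrivial H] {π : G →* unitary (H →L[ℂ] H)}
    (hirr : IsIrreducibleRep π)
    {A : H →L[ℂ] H} (hA : IsSelfAdjoint A) (hcomm : ∀ x, Commute A (π x : H →L[ℂ] H)) :
    ∃ c : ℝ, A = algebraMap ℝ (H →L[ℂ] H) c := by
  have key : ∀ p q : ℝ → ℝ, Continuous p → Continuous q → (∀ t, p t * q t = 0) →
      cfc p A = 0 ∨ cfc q A = 0 := by
    intro p q hp hq hpq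
    have hmul : cfc p A * cfc q A = 0 := by
      rw [← cfc_mul p q A hp.continuousOn hq.continuousOn]
      simp [hpq]
    rcases hirr (LinearMap.ker (cfc p A : H →L[ℂ] H).toLinearMap) (cfc p A).isClosed_ker
      (fun x η hη => by
        have hc := congrArg (fun B : H →L[ℂ] H => B η) ((hcomm x).cfc_real p).eq
        have h0 : cfc p A η = 0 := hη
        simp only [mul_apply_eq_comp, h0, map_zero] at hc
        exact hc) with h | h
    · right
      ext v
      have : cfc q A v ∈ LinearMap.ker (cfc p A : H →L[ℂ] H).toLinearMap :=
        congrArg (fun B : H →L[ℂ] H => B v) hmul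
      rw [h] at this
      simpa using this
    · left
      ext v
      have : v ∈ LinearMap.ker (cfc p A : H →L[ℂ] H).toLinearMap := by rw [h]; trivial
      exact this
  have hsub : ∀ a ∈ spectrum ℝ A, ∀ b ∈ spectrum ℝ A, ¬ a < b := by
    intro a ha b hb hab
    have hz : ∀ p : ℝ → ℝ, Continuous p → cfc p A = 0 → (spectrum ℝ A).EqOn p 0 := by
      intro p hp h0
      rw [← cfc_zero ℝ A] at h0
      exact (cfc_eq_cfc_iff_eqOn (hf := hp.continuousOn) (hg := continuousOn_const)).1 h0
    rcases key (fun t => max (t - (a + b) / 2) 0) (fun t => max ((a + b) / 2 - t) 0)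
      (by fun_prop) (by fun_prop) (fun t => by
        rcases le_total t ((a + b) / 2) with h | h
        · rw [max_eq_right (by linarith), zero_mul]
        · rw [max_eq_right (a := (a + b) / 2 - t) (by linarith), mul_zero]) with h | h
    · have := hz _ (by fun_prop) h hb
      simp only [Pi.zero_apply, max_eq_right_iff] at this
      linarith
    · have := hz _ (by fun_prop) h ha
      simp only [Pi.zero_apply, max_eq_right_iff] at this
      linarith
  obtain ⟨c, hc⟩ : (spectrum ℝ A).Nonempty := ContinuousFunctionalCalculus.spectrum_nonempty A hA
  refine ⟨c, ?_⟩
  rw [← cfc_const c A hA]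
  conv_lhs => rw [← cfc_id ℝ A hA]
  refine cfc_congr fun t ht => ?_
  exact le_antisymm (not_lt.1 (hsub c hc t ht)) (not_lt.1 (hsub t ht c hc))

end Schur

/-! ### The wavelet transform and left translation -/

section Transform

variable {G H : Type*} [Group G] [NormedAddCommGroup H] [InnerProductSpace ℂ H] [CompleteSpace H]
  (π : G →* unitary (H →L[ℂ] H))

theorem waveletTransform_rep (g f : H) (x y : G) :
    waveletTransform π g ((π x : H →L[ℂ] H) f) y = waveletTransform π g f (x⁻¹ * y) := by
  rw [waveletTransform, waveletTransform, rep_mul_apply, inner_rep_inv_left]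

theorem waveletTransform_one (g f : H) : waveletTransform π g f 1 = inner ℂ g f := by
  simp [waveletTransform]

variable [TopologicalSpace G] [IsTopologicalGroup G] [MeasurableSpace G] [BorelSpace G]
  (μ : Measure G) [μ.IsHaarMeasure]

/-- Left translation `(L_x F)(y) = F (x⁻¹ y)` as an isometry of `L²(G)`. -/
noncomputable def leftTranslation (x : G) : Lp ℂ 2 μ →ₗᵢ[ℂ] Lp ℂ 2 μ :=
  Lp.compMeasurePreservingₗᵢ ℂ (x⁻¹ * ·) (measurePreserving_mul_left μ x⁻¹)

theorem leftTranslation_ae_eq {g f : H} {F : Lp ℂ 2 μ} (hF : F =ᵐ[μ] waveletTransform π g f)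
    (x : G) : leftTranslation μ x F =ᵐ[μ] waveletTransform π g ((π x : H →L[ℂ] H) f) := by
  have hmp := measurePreserving_mul_left μ x⁻¹
  filter_upwards [Lp.coeFn_compMeasurePreserving F hmp, hmp.quasiMeasurePreserving.ae hF]
    with y h₁ h₂
  rw [waveletTransform_rep, ← h₂]
  exact h₁

end Transform

/-! ### The graph of the wavelet transform -/

section Graph

variable {G H : Type*} [Group G] [MeasurableSpace G]
  [NormedAddCommGroup H] [InnerProductSpace ℂ H] [CompleteSpace H]
  (π : G →* unitary (H →L[ℂ] H)) (μ : Measure G) (g : H)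

/-- The graph of `𝒲_g`, regarded as an operator from `{f | 𝒲_g f ∈ L²(G)}` to `L²(G)`, as a
subspace of the Hilbert space sum `H ⊕ L²(G)`. -/
def waveletGraph : Submodule ℂ (WithLp 2 (H × Lp ℂ 2 μ)) where
  carrier := {p | p.snd =ᵐ[μ] waveletTransform π g p.fst}
  zero_mem' := by
    filter_upwards [Lp.coeFn_zero ℂ 2 μ] with x hx
    simpa [waveletTransform] using hx
  add_mem' := by
    rintro p q hp hq
    filter_upwards [hp, hq, Lp.coeFn_add p.snd q.snd] with x h₁ h₂ h
    rw [WithLp.add_snd, h, Pi.add_apply, h₁, h₂]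
    simp [waveletTransform]
  smul_mem' := by
    rintro c p hp
    filter_upwards [hp, Lp.coeFn_smul c p.snd] with x h₁ h
    rw [WithLp.smul_snd, h, Pi.smul_apply, h₁]
    simp [waveletTransform]

/-- The wavelet transform is a closed operator: convergence in `H` makes the wavelet transforms
converge pointwise, and convergence in `L²(G)` makes a subsequence of them converge almost
everywhere. -/
theorem isClosed_waveletGraph :
    IsClosed (waveletGraph π μ g : Set (WithLp 2 (H × Lp ℂ 2 μ))) := by
  refine IsSeqClosed.isClosed fun u p hu hlim => ?_
  have hfst : Tendsto (fun n => (u n).fst) atTop (𝓝 p.fst) :=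
    ((WithLp.fstL 2 ℂ H (Lp ℂ 2 μ)).continuous.tendsto p).comp hlim
  have hsnd : Tendsto (fun n => (u n).snd) atTop (𝓝 p.snd) :=
    ((WithLp.sndL 2 ℂ H (Lp ℂ 2 μ)).continuous.tendsto p).comp hlim
  obtain ⟨ns, hns, hae⟩ := (tendstoInMeasure_of_tendsto_Lp hsnd).exists_seq_tendsto_ae
  change p.snd =ᵐ[μ] waveletTransform π g p.fst
  filter_upwards [hae, ae_all_iff.2 hu] with x hx hux
  refine tendsto_nhds_unique hx ?_
  simp only [hux]
  exact (tendsto_const_nhds (x := (π x : H →L[ℂ] H) g)).inner (hfst.comp hns.tendsto_atTop)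

instance completeSpace_waveletGraph : CompleteSpace (waveletGraph π μ g) :=
  (isClosed_waveletGraph π μ g).completeSpace_coe

/-- The projection of the graph of `𝒲_g` to `H`. -/
noncomputable def graphFst : waveletGraph π μ g →L[ℂ] H :=
  (WithLp.fstL 2 ℂ H (Lp ℂ 2 μ)).comp (waveletGraph π μ g).subtypeL

theorem graphFst_apply (γ : waveletGraph π μ g) : graphFst π μ g γ = γ.1.fst := rfl

theorem graphFst_injective : Function.Injective (graphFst π μ g) := by
  intro γ δ h
  have h₁ : γ.1.fst = δ.1.fst := h
  have h₂ : γ.1.snd = δ.1.snd := by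
    refine Lp.ext ?_
    filter_upwards [show γ.1.snd =ᵐ[μ] waveletTransform π g γ.1.fst from γ.2,
      show δ.1.snd =ᵐ[μ] waveletTransform π g δ.1.fst from δ.2] with x hx hy
    rw [hx, hy, h₁]
  exact Subtype.ext (WithLp.ofLp_injective 2 (Prod.ext h₁ h₂))

variable [TopologicalSpace G] [IsTopologicalGroup G] [BorelSpace G] [μ.IsHaarMeasure]

/-- The action of `G` on the graph of `𝒲_g`, by `π` on `H` and by left translation on `L²(G)`. -/
noncomputable def graphRep (x : G) (γ : waveletGraph π μ g) : waveletGraph π μ g :=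
  ⟨WithLp.toLp 2 ((π x : H →L[ℂ] H) γ.1.fst, leftTranslation μ x γ.1.snd),
    leftTranslation_ae_eq π μ γ.2 x⟩

theorem graphFst_graphRep (x : G) (γ : waveletGraph π μ g) :
    graphFst π μ g (graphRep π μ g x γ) = (π x : H →L[ℂ] H) (graphFst π μ g γ) := rfl

theorem graphRep_graphRep_inv (x : G) (γ : waveletGraph π μ g) :
    graphRep π μ g x (graphRep π μ g x⁻¹ γ) = γ := by
  apply graphFst_injective
  rw [graphFst_graphRep, graphFst_graphRep, ← rep_mul_apply]
  simp

theorem inner_graphRep_graphRep (x : G) (γ δ : waveletGraph π μ g) :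
    inner ℂ (graphRep π μ g x γ) (graphRep π μ g x δ) = inner ℂ γ δ := by
  rw [Submodule.coe_inner, Submodule.coe_inner, WithLp.prod_inner_apply, WithLp.prod_inner_apply]
  exact congrArg₂ (· + ·) (inner_rep_rep π x _ _) ((leftTranslation μ x).inner_map_map _ _)

theorem adjoint_graphFst_rep (x : G) (f : H) :
    ((graphFst π μ g)†) ((π x : H →L[ℂ] H) f) = graphRep π μ g x (((graphFst π μ g)†) f) := by
  refine ext_inner_left ℂ fun γ => ?_
  conv_rhs => rw [← graphRep_graphRep_inv π μ g x γ, inner_graphRep_graphRep]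
  rw [ContinuousLinearMap.adjoint_inner_right, ContinuousLinearMap.adjoint_inner_right,
    graphFst_graphRep, inner_rep_inv_left]

/-- For an irreducible representation the projection of the graph of `𝒲_g` to `H` is a multiple of
a unitary operator. -/
theorem exists_norm_sq_graphFst (hirr : IsIrreducibleRep π)
    (hg : IsSquareIntegrableVector π μ g) :
    ∃ c : ℝ, Function.Surjective (graphFst π μ g) ∧
      ∀ γ, ‖graphFst π μ g γ‖ ^ 2 = c * ‖γ‖ ^ 2 := by
  have : Nontrivial H := ⟨⟨g, 0, hg.1⟩⟩
  set j := graphFst π μ g with hj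
  obtain ⟨c, hc⟩ := eq_algebraMap_of_commute hirr (A := j ∘L j†)
    (by
      rw [ContinuousLinearMap.isSelfAdjoint_iff', ContinuousLinearMap.adjoint_comp,
        ContinuousLinearMap.adjoint_adjoint])
    (fun x => ContinuousLinearMap.ext fun f => by
      change j ((j†) ((π x : H →L[ℂ] H) f)) = (π x : H →L[ℂ] H) (j ((j†) f))
      rw [hj, adjoint_graphFst_rep, graphFst_graphRep])
  have hjj : ∀ f, j ((j†) f) = (c : ℂ) • f := fun f => by
    have h := congrArg (fun B : H →L[ℂ] H => B f) hc
    rw [Algebra.algebraMap_eq_smul_one] at h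
    simpa using h
  have hjj' : ∀ γ, (j†) (j γ) = (c : ℂ) • γ := fun γ => by
    apply graphFst_injective
    change j ((j†) (j γ)) = j ((c : ℂ) • γ)
    rw [hjj, map_smul]
  let γ₀ : waveletGraph π μ g := ⟨WithLp.toLp 2 (g, hg.2.toLp _), hg.2.coeFn_toLp⟩
  have hc0 : (c : ℂ) ≠ 0 := by
    intro h0
    have h₁ : inner ℂ (j γ₀) (j γ₀) = 0 := by
      rw [← ContinuousLinearMap.adjoint_inner_right, hjj', h0, zero_smul, inner_zero_right]
    exact hg.1 (inner_self_eq_zero.1 h₁)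
  refine ⟨c, fun f => ⟨(j†) ((c : ℂ)⁻¹ • f), ?_⟩, fun γ => ?_⟩
  · rw [hjj, smul_smul, mul_inv_cancel₀ hc0, one_smul]
  · have h₁ : inner ℂ (j γ) (j γ) = (c : ℂ) * inner ℂ γ γ := by
      rw [← ContinuousLinearMap.adjoint_inner_right, hjj']
      exact inner_smul_right γ γ _
    rw [inner_self_eq_norm_sq_to_K, show inner ℂ γ γ = (‖γ‖ : ℂ) ^ 2 from
      inner_self_eq_norm_sq_to_K γ] at h₁
    refine Complex.ofReal_injective ?_
    push_cast
    exact h₁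

/-- The wavelet transform with respect to an admissible vector is an isometry from the whole of `H`
into `L²(G)`. -/
theorem exists_linearIsometry (hirr : IsIrreducibleRep π) (hg : IsAdmissible π μ g) :
    ∃ Φ : H →ₗᵢ[ℂ] Lp ℂ 2 μ, ∀ f, Φ f =ᵐ[μ] waveletTransform π g f := by
  obtain ⟨c, hsurj, hnorm⟩ := exists_norm_sq_graphFst π μ g hirr hg.1
  have hmem : ∀ f, MemLp (waveletTransform π g f) 2 μ := fun f => by
    obtain ⟨γ, rfl⟩ := hsurj f
    exact (memLp_congr_ae γ.2).1 (Lp.memLp γ.1.snd)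
  let Φ : H →ₗ[ℂ] Lp ℂ 2 μ :=
    { toFun := fun f => (hmem f).toLp _
      map_add' := fun u v => by
        rw [← MemLp.toLp_add]
        exact MemLp.toLp_congr _ _ (.of_forall fun x => by simp [waveletTransform])
      map_smul' := fun a u => by
        rw [RingHom.id_apply, ← MemLp.toLp_const_smul]
        exact MemLp.toLp_congr _ _
          (.of_forall fun x => by simp [waveletTransform]) }
  have hΦ : ∀ f, Φ f =ᵐ[μ] waveletTransform π g f := fun f => (hmem f).coeFn_toLp
  have hsq : ∀ f, ‖f‖ ^ 2 = c * (‖f‖ ^ 2 + ‖Φ f‖ ^ 2) := fun f => by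
    have h := hnorm ⟨WithLp.toLp 2 (f, Φ f), hΦ f⟩
    rwa [Submodule.coe_norm, WithLp.prod_norm_sq_eq_of_L2] at h
  have hgn : ‖Φ g‖ = ‖g‖ := by
    rw [← toReal_enorm g, ← hg.2]
    exact Lp.norm_toLp _ (hmem g)
  have hg0 : ‖g‖ ^ 2 ≠ 0 := by simpa using hg.1.1
  have hc : c = 1 / 2 := by
    have h := hsq g
    rw [hgn] at h
    have h2 : ‖g‖ ^ 2 * (2 * c - 1) = 0 := by linear_combination -h
    rcases mul_eq_zero.1 h2 with h3 | h3
    · exact absurd h3 hg0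
    · linarith
  refine ⟨⟨Φ, fun f => ?_⟩, hΦ⟩
  have h := hsq f
  rw [hc] at h
  exact (sq_eq_sq₀ (norm_nonneg _) (norm_nonneg _)).1 (by linarith)

end Graph

/-! ### Wavelet spaces with nonzero intersection -/

section Intersection

variable {G H K : Type*} [Group G]
  [NormedAddCommGroup H] [InnerProductSpace ℂ H] [CompleteSpace H]
  [NormedAddCommGroup K] [InnerProductSpace ℂ K] [CompleteSpace K]
  {π : G →* unitary (H →L[ℂ] H)} {ρ : G →* unitary (K →L[ℂ] K)} {g : H} {h : K}

theorem waveletTransform_rep_eq {f : H} {k : K}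
    (e : waveletTransform π g f = waveletTransform ρ h k) (x : G) :
    waveletTransform π g ((π x : H →L[ℂ] H) f) = waveletTransform ρ h ((ρ x : K →L[ℂ] K) k) := by
  ext y
  rw [waveletTransform_rep, waveletTransform_rep, e]

variable [MeasurableSpace G] {μ : Measure G} {Φ : H →ₗᵢ[ℂ] Lp ℂ 2 μ} {Ψ : K →ₗᵢ[ℂ] Lp ℂ 2 μ}

theorem mem_waveletSpace_iff (hΦ : ∀ f, Φ f =ᵐ[μ] waveletTransform π g f) {F : Lp ℂ 2 μ} :
    F ∈ waveletSpace π μ g ↔ ∃ f, Φ f = F :=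
  exists_congr fun f => ⟨fun hF => Lp.ext ((hΦ f).trans hF.symm), fun hF => hF ▸ hΦ f⟩

variable [TopologicalSpace G] [μ.IsHaarMeasure]

/-- Nonempty open sets have positive Haar measure, so that continuous functions which are equal
almost everywhere are equal. -/
theorem map_eq_map_iff (hπ : IsUnitaryRepresentation π) (hρ : IsUnitaryRepresentation ρ)
    (hΦ : ∀ f, Φ f =ᵐ[μ] waveletTransform π g f) (hΨ : ∀ k, Ψ k =ᵐ[μ] waveletTransform ρ h k)
    {f : H} {k : K} : Φ f = Ψ k ↔ waveletTransform π g f = waveletTransform ρ h k := by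
  rw [← (hπ f g).ae_eq_iff_eq μ (hρ k h)]
  exact ⟨fun e => (hΦ f).symm.trans (e ▸ hΨ k),
    fun e => Lp.ext (((hΦ f).trans e).trans (hΨ k).symm)⟩

/-- If the wavelet space of `g` meets that of `h` nontrivially, it is contained in it: the vectors
whose wavelet transforms lie in the wavelet space of `h` form a closed invariant subspace. -/
theorem exists_waveletTransform_eq (hπ : IsUnitaryRepresentation π)
    (hρ : IsUnitaryRepresentation ρ) (hirr : IsIrreducibleRep π)
    (hΦ : ∀ f, Φ f =ᵐ[μ] waveletTransform π g f) (hΨ : ∀ k, Ψ k =ᵐ[μ] waveletTransform ρ h k)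
    (hinter : waveletSpace π μ g ⊓ waveletSpace ρ μ h ≠ ⊥) (f : H) : ∃ k, Φ f = Ψ k := by
  let M : Submodule ℂ H := (LinearMap.range Ψ.toLinearMap).comap Φ.toLinearMap
  have hclosed : IsClosed (M : Set H) := by
    have hrange : IsClosed (Set.range Ψ) := Ψ.isometry.isClosedEmbedding.isClosed_range
    exact hrange.preimage Φ.continuous
  have htop : M = ⊤ := by
    refine (hirr M hclosed fun x η => ?_).resolve_left fun hbot => ?_
    · rintro ⟨k, hk⟩
      have e := (map_eq_map_iff hπ hρ hΦ hΨ).1 (show Φ η = Ψ k from hk.symm)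
      exact ⟨(ρ x : K →L[ℂ] K) k,
        ((map_eq_map_iff hπ hρ hΦ hΨ).2 (waveletTransform_rep_eq e x)).symm⟩
    · obtain ⟨F, ⟨hF₁, hF₂⟩, hF₀⟩ := Submodule.exists_mem_ne_zero_of_ne_bot hinter
      obtain ⟨η, rfl⟩ := (mem_waveletSpace_iff hΦ).1 hF₁
      obtain ⟨k, hk⟩ := (mem_waveletSpace_iff hΨ).1 hF₂
      have hη : η ∈ M := ⟨k, hk⟩
      rw [hbot, Submodule.mem_bot] at hη
      exact hF₀ (by rw [hη, map_zero])
  obtain ⟨k, hk⟩ : f ∈ M := htop ▸ Submodule.mem_top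
  exact ⟨k, hk.symm⟩

end Intersection

end WaveletSpaces

theorem theorem4p2
    {G : Type*} [Group G] [TopologicalSpace G] [IsTopologicalGroup G] [T2Space G]
    [LocallyCompactSpace G] [MeasurableSpace G] [BorelSpace G]
    (μ : Measure G) [μ.IsHaarMeasure] [μ.Regular]
    {H K : Type*}
    [NormedAddCommGroup H] [InnerProductSpace ℂ H] [CompleteSpace H]
    [NormedAddCommGroup K] [InnerProductSpace ℂ K] [CompleteSpace K]
    (π : G →* unitary (H →L[ℂ] H)) (ρ : G →* unitary (K →L[ℂ] K))
    (hπ : WaveletSpaces.IsSquareIntegrableRep π μ)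
    (hρ : WaveletSpaces.IsSquareIntegrableRep ρ μ)
    (g : H) (h : K)
    (hg : WaveletSpaces.IsAdmissible π μ g)
    (hh : WaveletSpaces.IsAdmissible ρ μ h)
    (hinter : WaveletSpaces.waveletSpace π μ g ⊓ WaveletSpaces.waveletSpace ρ μ h ≠ ⊥) :
    WaveletSpaces.waveletSpace π μ g = WaveletSpaces.waveletSpace ρ μ h ∧
      ∃ T : H ≃ₗᵢ[ℂ] K,
        (∀ (x : G) (f : H), T ((π x : H →L[ℂ] H) f) = (ρ x : K →L[ℂ] K) (T f)) ∧ T g = h := by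
  obtain ⟨Φ, hΦ⟩ := WaveletSpaces.exists_linearIsometry π μ g hπ.isIrreducible hg
  obtain ⟨Ψ, hΨ⟩ := WaveletSpaces.exists_linearIsometry ρ μ h hρ.isIrreducible hh
  have hπu := hπ.isUnitaryRepresentation
  have hρu := hρ.isUnitaryRepresentation
  have hΦΨ := WaveletSpaces.exists_waveletTransform_eq hπu hρu hπ.isIrreducible hΦ hΨ hinter
  have hΨΦ := WaveletSpaces.exists_waveletTransform_eq hρu hπu hρ.isIrreducible hΨ hΦ
    (inf_comm (WaveletSpaces.waveletSpace π μ g) _ ▸ hinter)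
  refine ⟨?_, ?_⟩
  · ext F
    rw [WaveletSpaces.mem_waveletSpace_iff hΦ, WaveletSpaces.mem_waveletSpace_iff hΨ]
    constructor
    · rintro ⟨f, rfl⟩
      exact (hΦΨ f).imp fun _ e => e.symm
    · rintro ⟨k, rfl⟩
      exact (hΨΦ k).imp fun _ e => e.symm
  · choose S hS using hΦΨ
    let T₀ : H →ₗᵢ[ℂ] K :=
      { toFun := S
        map_add' := fun u v => Ψ.injective (by rw [← hS, map_add, map_add, ← hS, ← hS])
        map_smul' := fun a u => Ψ.injective (by
          rw [← hS, map_smul, RingHom.id_apply, map_smul, ← hS])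
        norm_map' := fun u => by
          change ‖S u‖ = ‖u‖
          rw [← Ψ.norm_map, ← hS, Φ.norm_map] }
    have hsurj : Function.Surjective T₀ := fun k => by
      obtain ⟨f, hf⟩ := hΨΦ k
      exact ⟨f, Ψ.injective ((hS f).symm.trans hf.symm)⟩
    have hTS : ∀ f, WaveletSpaces.waveletTransform π g f =
        WaveletSpaces.waveletTransform ρ h (S f) :=
      fun f => (WaveletSpaces.map_eq_map_iff hπu hρu hΦ hΨ).1 (hS f)
    refine ⟨LinearIsometryEquiv.ofSurjective T₀ hsurj, fun x f => ?_, ?_⟩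
    · refine Ψ.injective ((hS _).symm.trans ?_)
      exact (WaveletSpaces.map_eq_map_iff hπu hρu hΦ hΨ).2
        (WaveletSpaces.waveletTransform_rep_eq (hTS f) x)
    · -- Both sides have the same inner products with `T f`, namely `𝒲_g f 1 = 𝒲_h (T f) 1`.
      refine ext_inner_right ℂ fun k => ?_
      obtain ⟨f, rfl⟩ := hsurj k
      have e := congrFun (hTS f) 1
      rw [WaveletSpaces.waveletTransform_one, WaveletSpaces.waveletTransform_one] at e
      exact (T₀.inner_map_map g f).trans e
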